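/- Let $n\ge 3$ and let $\Gamma$ be a connected simple graph with vertex set $\{2,\dots,n\}$ (so $\Gamma$ has $n-1$ vertices); let $K_{n-1}$ be the complete graph on the same vertices. For a graph $G$ on these vertices let $\mathbb R^{E(G)}$ have standard basis $(v_e)_{e\in E(G)}$ and let $L\subset\mathbb R^{E(G)}$ be the line spanned by the all-ones vector. **Tropical curves.** A rational $n$-marked tropical curve $C$ is a finite tree with a positive length on every (bounded) edge and with $n$ unbounded ends labelled $1,\dots,n$ attached to its vertices, such that every vertex has valence at least $3$, ends included. Let $\operatorname{dist}(i,j)$ be the sum of the lengths of the bounded edges between the ends $i$ and $j$, and let $d(C)$ be the class of $(\operatorname{dist}(i,j))_{i<j}$ in $Q_n=\mathbb R^{\binom n2}/\Phi(\mathbb R^n)$, where $\Phi(x)=(x_i+x_j)_{i<j}$. The curve is radially aligned when it is equipped with the weak ordering of its vertices by their distance from the root vertex, i.e. the vertex carrying the end $1$; its radially aligned combinatorial type is obtained by forgetting the lengths and keeping the tree, the labelled ends and the weak ordering. $M_{0,n}^{\mathrm{rad}}\subset Q_n$ is the set of all $d(C)$. As a fan, it has one closed cone for each radially aligned combinatorial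 type, consisting of the points $d$ given by all edge lengths $\ge 0$ on the tree for which the distances of the vertices from the root vertex are weakly monotone for the weak ordering. **Projection.** Let $\Psi:Q_n\to\mathbb R^{E(K_{n-1})}/L$ be the linear isomorphism induced by $(d_{ij})\mapsto\left(\tfrac12(d_{ij}-d_{1i}-d_{1j})\right)_{2\le i<j\le n}$. It sends the curve with exactly one bounded edge, of length $1$, separating the ends in $I\not\ni 1$ from the others, to the class of $-\sum_{e\subseteq I}v_e$. Let $\mathrm{pr}_\Gamma:Q_n\to\mathbb R^{E(\Gamma)}/L$ be $\Psi$ followed by the map that forgets the coordinates of the edges not in $\Gamma$. **Bergman fan.** Let $M$ be the cycle matroid of $\Gamma$ (ground set $E(\Gamma)$, independent sets the forests). Then $B'(\Gamma)=B(\Gamma)/L$, where $B(\Gamma)$ is the set of all $w\in\mathbb R^{E(\Gamma)}$ such that the matroid $M_w$, whose bases are the bases of $M$ of minimal $w$-weight, has no loops. As a fan, $B'(\Gamma)$ carries the chains-of-flats subdivision: its cones are the cones in $\mathbb R^{E(\Gamma)}/L$ spanned by the classes of $\rho_{F_1},\dots,\rho_{F_r}$, where $r\ge0$, $\emptyset\subsetneq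 F_1\subsetneq\dots\subsetneq F_r\subsetneq E(\Gamma)$ is a chain of flats of $M$ and $\rho_F=-\sum_{e\in F}v_e$. **Theorem.** $\mathrm{pr}_\Gamma(M_{0,n}^{\mathrm{rad}})=B'(\Gamma)$, both as sets and as fans: the image of $M_{0,n}^{\mathrm{rad}}$ under $\mathrm{pr}_\Gamma$ is the set $B'(\Gamma)$, and the images of the cones of $M_{0,n}^{\mathrm{rad}}$ under $\mathrm{pr}_\Gamma$ are exactly the cones of the chains-of-flats subdivision of $B'(\Gamma)$. -/

import Mathlib

/-!
Throughout, the number of marked ends is `n = m + 1`.  The ends are labelled by `Fin (m + 1)`: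
`0` is the root end (the end usually marked `1`), and `i.succ`, for `i : Fin m`, are the others.
Graphs on `n - 1 = m` vertices have vertex set `Fin m`; vertex `i` corresponds to the end `i.succ`.
-/

namespace RadialCurves

open Set

/-! ### The cycle matroid of a graph -/

section CycleMatroid

variable {V : Type*}

/-- A set of edges of `Γ` is a forest if the graph with exactly these edges has no cycle. -/
def IsForest (Γ : SimpleGraph V) (I : Set (Sym2 V)) : Prop :=
  I ⊆ Γ.edgeSet ∧ (SimpleGraph.fromEdgeSet I).IsAcyclic

theorem IsForest.fromEdgeSet_le {Γ : SimpleGraph V} {I : Set (Sym2 V)} (h : IsForest Γ I) :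
    SimpleGraph.fromEdgeSet I ≤ Γ :=
  (SimpleGraph.fromEdgeSet_le Γ).2 (sdiff_subset.trans h.1)

theorem maximal_isForest_iff {Γ : SimpleGraph V} {I : Set (Sym2 V)} (h : IsForest Γ I) :
    Maximal (IsForest Γ) I ↔ (SimpleGraph.fromEdgeSet I).Reachable = Γ.Reachable := by
  rw [← SimpleGraph.maximal_isAcyclic_iff_reachable_eq h.fromEdgeSet_le h.2]
  have key : ∀ J, IsForest Γ J → (SimpleGraph.fromEdgeSet J).edgeSet = J := fun J hJ => by
    rw [SimpleGraph.edgeSet_fromEdgeSet]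
    refine sdiff_eq_left.2 (Set.disjoint_left.2 fun e he hd => ?_)
    exact Γ.not_isDiag_of_mem_edgeSet (hJ.1 he) hd
  constructor
  · rintro ⟨-, hmax⟩
    refine ⟨⟨h.fromEdgeSet_le, h.2⟩, fun H hH hIH => ?_⟩
    have hF : IsForest Γ H.edgeSet :=
      ⟨SimpleGraph.edgeSet_mono hH.1, by rw [SimpleGraph.fromEdgeSet_edgeSet]; exact hH.2⟩
    have hsub : I ⊆ H.edgeSet := by
      have := SimpleGraph.edgeSet_mono hIH
      rwa [key I h] at this
    have := hmax hF hsub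
    rw [← SimpleGraph.fromEdgeSet_edgeSet H]
    exact SimpleGraph.fromEdgeSet_mono this
  · rintro ⟨-, hmax⟩
    refine ⟨h, fun J hJ hIJ => ?_⟩
    have := hmax ⟨hJ.fromEdgeSet_le, hJ.2⟩ (SimpleGraph.fromEdgeSet_mono hIJ)
    have := SimpleGraph.edgeSet_mono this
    rwa [key I h, key J hJ] at this

theorem IsForest.exists_insert {Γ : SimpleGraph V} {I B : Set (Sym2 V)} (hI : IsForest Γ I)
    (hnot : ¬ Maximal (IsForest Γ) I) (hB : Maximal (IsForest Γ) B) :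
    ∃ x ∈ B \ I, IsForest Γ (insert x I) := by
  by_contra hcon
  push Not at hcon
  apply hnot
  rw [maximal_isForest_iff hI]
  have hBr := (maximal_isForest_iff hB.prop).1 hB
  have hadj : ∀ u v, (SimpleGraph.fromEdgeSet B).Adj u v →
      (SimpleGraph.fromEdgeSet I).Reachable u v := by
    intro u v huv
    rw [SimpleGraph.fromEdgeSet_adj] at huv
    by_contra hr
    have hnI : s(u, v) ∉ I := fun hm =>
      hr (SimpleGraph.Adj.reachable ((SimpleGraph.fromEdgeSet_adj I).2 ⟨hm, huv.2⟩))
    refine hcon _ ⟨huv.1, hnI⟩ ⟨insert_subset (hB.prop.1 huv.1) hI.1, ?_⟩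
    have := hI.2.sup_edge_of_not_reachable hr
    rwa [SimpleGraph.edge, ← SimpleGraph.fromEdgeSet_union, union_comm, singleton_union] at this
  rw [← hBr]
  ext u v
  constructor
  · intro h
    rw [hBr]
    exact h.mono hI.fromEdgeSet_le
  · rintro ⟨p⟩
    induction p with
    | nil => exact SimpleGraph.Reachable.refl _
    | cons h _ ih => exact (hadj _ _ h).trans ih

/-- The cycle matroid of `Γ`: the ground set is the edge set of `Γ`, and the independent sets are
the forests of `Γ`. -/
def cycleMatroid [Finite V] (Γ : SimpleGraph V) : Matroid (Sym2 V) :=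
  IndepMatroid.matroid
    { E := Γ.edgeSet
      Indep := IsForest Γ
      indep_empty := ⟨empty_subset _, by simp⟩
      indep_subset := fun _ _ hJ hIJ =>
        ⟨hIJ.trans hJ.1, hJ.2.anti (SimpleGraph.fromEdgeSet_mono hIJ)⟩
      indep_aug := fun _ _ hI hnot hB => hI.exists_insert hnot hB
      indep_maximal := fun X _ => Matroid.existsMaximalSubsetProperty_of_bdd
        ⟨(univ : Set (Sym2 V)).ncard, fun Y _ => by
          rw [(Set.toFinite _).cast_ncard_eq]
          exact encard_le_encard (subset_univ Y)⟩ X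
      subset_ground := fun _ hI => hI.1 }

end CycleMatroid

/-! ### The Bergman fan of a matroid -/

section Bergman

variable {α : Type*}

/-- The `w`-weight `∑_{e ∈ B} w_e` of a set `B` of elements of the ground set. -/
noncomputable def weight (M : Matroid α) (w : M.E → ℝ) (B : Set α) : ℝ :=
  ∑ᶠ e ∈ ((↑) ⁻¹' B : Set M.E), w e

/-- `B` is a base of `M` of minimal `w`-weight. -/
def IsMinBase (M : Matroid α) (w : M.E → ℝ) (B : Set α) : Prop :=
  M.IsBase B ∧ ∀ B', M.IsBase B' → weight M w B ≤ weight M w B'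

theorem weight_exchange (M : Matroid α) [M.Finite] (w : M.E → ℝ) (B : Set α) (x y : M.E)
    (hx : (x : α) ∈ B) (hy : (y : α) ∉ B) :
    weight M w (insert (y : α) (B \ {(x : α)})) = weight M w B - w x + w y := by
  have : Finite M.E := M.ground_finite.to_subtype
  have key : ∀ (z : M.E) (A : Set α), (z : α) ∉ A →
      weight M w (insert (z : α) A) = w z + weight M w A := by
    intro z A hz
    have h : ((↑) ⁻¹' (insert (z : α) A) : Set M.E) = insert z ((↑) ⁻¹' A) := by
      ext e
      simp [Subtype.ext_iff]
    rw [weight, h, finsum_mem_insert w (show z ∉ ((↑) ⁻¹' A : Set M.E) from hz) (Set.toFinite _)]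
    rfl
  have h₁ := key y (B \ {(x : α)}) fun h => hy h.1
  have h₂ := key x (B \ {(x : α)}) fun h => h.2 rfl
  rw [insert_sdiff_singleton, insert_eq_of_mem hx] at h₂
  linarith

theorem exists_isMinBase (M : Matroid α) [M.Finite] (w : M.E → ℝ) : ∃ B, IsMinBase M w B := by
  have hfin : {B | M.IsBase B}.Finite :=
    M.ground_finite.finite_subsets.subset fun B hB => hB.subset_ground
  obtain ⟨B, hB, hmin⟩ := Set.exists_min_image _ (weight M w) hfin M.exists_isBase
  exact ⟨B, hB, hmin⟩

theorem isMinBase_exchange (M : Matroid α) [M.Finite] (w : M.E → ℝ) :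
    Matroid.ExchangeProperty (IsMinBase M w) := by
  rintro B₁ B₂ ⟨hB₁, hm₁⟩ ⟨hB₂, hm₂⟩ x ⟨hx₁, hx₂⟩
  have hxE : x ∈ M.E := hB₁.subset_ground hx₁
  have hC := hB₂.fundCircuit_isCircuit hxE hx₂
  have hK := Matroid.fundCocircuit_isCocircuit hx₁ hB₁
  obtain ⟨y, ⟨hyC, hyK⟩, hyx⟩ := (hC.isCocircuit_inter_nontrivial hK
    ⟨x, M.mem_fundCircuit _ _, M.mem_fundCocircuit _ _⟩).exists_ne x
  have hyB₂ : y ∈ B₂ := ((M.fundCircuit_subset_insert x B₂) hyC).resolve_left hyx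
  have hy := ((M.fundCocircuit_subset_insert_compl x B₁) hyK).resolve_left hyx
  have hb₂ : M.IsBase (insert x (B₂ \ {y})) := by
    refine hB₂.exchange_isBase_of_indep hx₂ ?_
    rw [hB₂.indep.mem_fundCircuit_iff (by rwa [hB₂.closure_eq]) hx₂] at hyC
    rwa [insert_sdiff_singleton_comm hyx.symm]
  have hb₁ : M.IsBase (insert y (B₁ \ {x})) := by
    refine hB₁.exchange_isBase_of_indep hy.2 ?_
    rw [hB₁.mem_fundCocircuit_iff_mem_fundCircuit,
      hB₁.indep.mem_fundCircuit_iff (by rw [hB₁.closure_eq]; exact hy.1) hy.2] at hyK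
    rwa [insert_sdiff_singleton_comm hyx]
  have e₁ := weight_exchange M w B₁ ⟨x, hxE⟩ ⟨y, hy.1⟩ hx₁ hy.2
  have e₂ := weight_exchange M w B₂ ⟨y, hy.1⟩ ⟨x, hxE⟩ hyB₂ hx₂
  refine ⟨y, ⟨hyB₂, hy.2⟩, hb₁, fun B' hB' => ?_⟩
  have := hm₁ B' hB'
  have := hm₂ _ hb₂
  simp only at e₁ e₂
  linarith

/-- The matroid `M_w`: its ground set is that of `M`, and its bases are the bases of `M` of minimal
`w`-weight. -/
noncomputable def initialMatroid (M : Matroid α) [M.Finite] (w : M.E → ℝ) : Matroid α :=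
  Matroid.ofIsBaseOfFinite M.ground_finite (IsMinBase M w) (exists_isMinBase M w)
    (isMinBase_exchange M w) fun _ hB => hB.1.subset_ground

/-- The line `L` spanned by the all-ones vector of `ℝ^E`. -/
def lineality (E : Set α) : Submodule ℝ (E → ℝ) := Submodule.span ℝ {1}

/-- The Bergman fan of `M` in `ℝ^E`, as a set: all `w` such that `M_w` has no loops. -/
def bergmanFan (M : Matroid α) [M.Finite] : Set (M.E → ℝ) :=
  {w | (initialMatroid M w).Loopless}

/-- The reduced Bergman fan `B'(M) = B(M) / L`, as a subset of `ℝ^E / L`. -/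
def reducedBergmanFan (M : Matroid α) [M.Finite] : Set ((M.E → ℝ) ⧸ lineality M.E) :=
  (lineality M.E).mkQ '' bergmanFan M

/-- The vector `ρ_F = - ∑_{e ∈ F} v_e`. -/
noncomputable def flatRay (M : Matroid α) (F : Set α) : M.E → ℝ :=
  fun e => -F.indicator 1 (e : α)

/-- A chain `∅ ⊊ F₁ ⊊ ⋯ ⊊ F_r ⊊ E` of flats of `M`. -/
structure IsFlatChain (M : Matroid α) {r : ℕ} (F : Fin r → Set α) : Prop where
  isFlat : ∀ k, M.IsFlat (F k)
  strictMono : StrictMono F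
  nonempty : ∀ k, (F k).Nonempty
  ne_ground : ∀ k, F k ≠ M.E

/-- The cone in `ℝ^E / L` spanned by the classes of `ρ_{F₁}, …, ρ_{F_r}`. -/
def flatCone (M : Matroid α) {r : ℕ} (F : Fin r → Set α) : Set ((M.E → ℝ) ⧸ lineality M.E) :=
  {x | ∃ a : Fin r → ℝ, (∀ k, 0 ≤ a k) ∧
    x = (lineality M.E).mkQ (∑ k, a k • flatRay M (F k))}

/-- The cones of the chains-of-flats subdivision of `B'(M)`. -/
def bergmanCones (M : Matroid α) : Set (Set ((M.E → ℝ) ⧸ lineality M.E)) :=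
  {σ | ∃ (r : ℕ) (F : Fin r → Set α), IsFlatChain M F ∧ σ = flatCone M F}

end Bergman

/-! ### Radially aligned tropical curves -/

/-- A combinatorial type of rational tropical curves with `m + 1` marked ends: a finite tree
together with the vertex to which each end is attached, such that every vertex has valence
(number of bounded edges plus number of ends) at least three. -/
structure CombType (m : ℕ) where
  V : Type
  [finite : Finite V]
  tree : SimpleGraph V
  isTree : tree.IsTree
  mark : Fin (m + 1) → V
  stable : ∀ v, 3 ≤ (tree.neighborSet v).ncard + {i | mark i = v}.ncard

namespace CombType

variable {m : ℕ} (T : CombType m)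

/-- The root vertex: the vertex carrying the end `0`. -/
def root : T.V := T.mark 0

/-- The unique path between two vertices of the tree. -/
noncomputable def path (u v : T.V) : T.tree.Walk u v :=
  (T.isTree.existsUnique_path u v).choose

/-- The sum of the lengths `ℓ` of the bounded edges on the path from `u` to `v`. -/
noncomputable def dist (ℓ : Sym2 T.V → ℝ) (u v : T.V) : ℝ :=
  ((T.path u v).edges.map ℓ).sum

theorem dist_comm (ℓ : Sym2 T.V → ℝ) (u v : T.V) : T.dist ℓ u v = T.dist ℓ v u := by
  have h : T.path v u = (T.path u v).reverse :=
    ((T.isTree.existsUnique_path v u).choose_spec.2 _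
      (T.isTree.existsUnique_path u v).choose_spec.1.reverse).symm
  simp [dist, h, SimpleGraph.Walk.edges_reverse]

end CombType

/-- The set of unordered pairs of distinct elements. -/
abbrev Pairs (k : ℕ) : Set (Sym2 (Fin k)) := (⊤ : SimpleGraph (Fin k)).edgeSet

/-- The map `Φ : ℝ^n → ℝ^(n choose 2)`, `x ↦ (x_i + x_j)_{i < j}`. -/
def sumPairs (k : ℕ) : (Fin k → ℝ) →ₗ[ℝ] (Pairs k → ℝ) where
  toFun x e := Sym2.lift ⟨fun i j => x i + x j, fun _ _ => add_comm _ _⟩ (e : Sym2 (Fin k))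
  map_add' x y := by
    ext ⟨e, he⟩
    induction e with | _ i j => simp; ring
  map_smul' c x := by
    ext ⟨e, he⟩
    induction e with | _ i j => simp; ring

/-- The space `Q_n = ℝ^(n choose 2) / Φ(ℝ^n)`, with `n = k`. -/
abbrev Q (k : ℕ) : Type := (Pairs k → ℝ) ⧸ LinearMap.range (sumPairs k)

/-- The vector `(dist(i, j))_{i < j}` of distances between the ends. -/
noncomputable def CombType.distVector {m : ℕ} (T : CombType m) (ℓ : Sym2 T.V → ℝ) :
    Pairs (m + 1) → ℝ :=
  fun e => Sym2.lift ⟨fun i j => T.dist ℓ (T.mark i) (T.mark j), fun _ _ => T.dist_comm _ _ _⟩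
    (e : Sym2 (Fin (m + 1)))

/-- The class of the vector of distances in `Q_n`. -/
noncomputable def CombType.point {m : ℕ} (T : CombType m) (ℓ : Sym2 T.V → ℝ) : Q (m + 1) :=
  (LinearMap.range (sumPairs (m + 1))).mkQ (T.distVector ℓ)

/-- A rational tropical curve with `m + 1` marked ends: a combinatorial type together with a
positive length for each bounded edge (the values of `length` elsewhere are irrelevant). -/
structure Curve (m : ℕ) extends CombType m where
  length : Sym2 V → ℝ
  length_pos : ∀ e ∈ tree.edgeSet, 0 < length e

/-- The distance of a vertex from the root vertex. -/
noncomputable def Curve.radius {m : ℕ} (C : Curve m) (v : C.V) : ℝ :=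
  C.toCombType.dist C.length C.root v

/-- A radially aligned tropical curve: a tropical curve with the weak ordering of its vertices
given by their distances from the root vertex. -/
structure RadialCurve (m : ℕ) extends Curve m where
  le : V → V → Prop
  le_iff : ∀ u v, le u v ↔ toCurve.radius u ≤ toCurve.radius v

/-- A radially aligned combinatorial type: what is left of a radially aligned curve when the
lengths are forgotten and the weak ordering of the vertices is kept. -/
structure RadialType (m : ℕ) extends CombType m where
  le : V → V → Prop
  realizable : ∃ ℓ : Sym2 V → ℝ, (∀ e ∈ tree.edgeSet, 0 < ℓ e) ∧
    ∀ u v, le u v ↔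
      toCombType.dist ℓ toCombType.root u ≤ toCombType.dist ℓ toCombType.root v

/-- The closed cone of a radially aligned combinatorial type in `Q_n`: lengths of bounded edges may
shrink to zero, and the radii of the vertices are weakly monotone for the given weak ordering. -/
def RadialType.cone {m : ℕ} (T : RadialType m) : Set (Q (m + 1)) :=
  {x | ∃ ℓ : Sym2 T.V → ℝ, (∀ e ∈ T.tree.edgeSet, 0 ≤ ℓ e) ∧
    (∀ u v, T.le u v → T.toCombType.dist ℓ T.root u ≤ T.toCombType.dist ℓ T.root v) ∧
    x = T.toCombType.point ℓ}

/-- The moduli space `M_{0,n}^rad` with `n = m + 1`, embedded in `Q_n`, as a set of points. -/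
def radialModuli (m : ℕ) : Set (Q (m + 1)) :=
  {x | ∃ C : RadialCurve m, x = C.toCombType.point C.length}

/-- The cones of `M_{0,n}^rad`, `n = m + 1`: one for each radially aligned combinatorial type. -/
def radialCones (m : ℕ) : Set (Set (Q (m + 1))) :=
  {σ | ∃ T : RadialType m, σ = T.cone}

/-! ### The identification of the ambient spaces, and the projection -/

/-- The cycle matroid of the complete graph on `m = n - 1` vertices. -/
abbrev completeMatroid (m : ℕ) : Matroid (Sym2 (Fin m)) := cycleMatroid ⊤

/-- The space `ℝ^{E(Γ)} / L`. -/
abbrev EdgeSpace {m : ℕ} (Γ : SimpleGraph (Fin m)) : Type :=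
  ((cycleMatroid Γ).E → ℝ) ⧸ lineality (cycleMatroid Γ).E

/-- The pair `{0, i + 1}` of ends. -/
def rootPair {m : ℕ} (i : Fin m) : Pairs (m + 1) :=
  ⟨s(0, i.succ), by simpa using (Fin.succ_ne_zero i).symm⟩

/-- The pair `{i + 1, j + 1}` of ends for an edge `{i, j}` of the complete graph. -/
def succPair {m : ℕ} (e : (completeMatroid m).E) : Pairs (m + 1) :=
  ⟨Sym2.map Fin.succ e.1, by
    obtain ⟨e, he⟩ := e
    induction e with
    | _ i j =>
      have he' : i ≠ j := by
        have : (⊤ : SimpleGraph (Fin m)).Adj i j := he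
        exact this.ne
      simpa using he'⟩

/-- The linear map `d ↦ ((d_{ij} - d_{1i} - d_{1j}) / 2)_{ij}` from `ℝ^(n choose 2)` to
`ℝ^{E(K_{n-1})}`. -/
noncomputable def toEdges (m : ℕ) :
    (Pairs (m + 1) → ℝ) →ₗ[ℝ] ((completeMatroid m).E → ℝ) where
  toFun d e := (d (succPair e) - Sym2.lift
    ⟨fun i j => d (rootPair i) + d (rootPair j), fun _ _ => add_comm _ _⟩ e.1) / 2
  map_add' x y := by
    ext ⟨e, he⟩
    induction e with | _ i j => simp; ring
  map_smul' c x := by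
    ext ⟨e, he⟩
    induction e with | _ i j => simp; ring

theorem toEdges_sumPairs (m : ℕ) (x : Fin (m + 1) → ℝ) :
    toEdges m (sumPairs (m + 1) x) = (-x 0) • 1 := by
  ext ⟨e, he⟩
  induction e with | _ i j => simp [toEdges, sumPairs, succPair, rootPair]; ring

theorem toEdges_surjective (m : ℕ) : Function.Surjective (toEdges m) := by
  intro w
  classical
  let w' : Sym2 (Fin m) → ℝ := fun e => if he : e ∈ (completeMatroid m).E then w ⟨e, he⟩ else 0
  refine ⟨fun e => Sym2.lift ⟨fun a b => Fin.cases 0 (fun i => Fin.cases 0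
    (fun j => 2 * w' s(i, j)) b) a, fun a b => ?_⟩ e.1, ?_⟩
  · cases a using Fin.cases <;> cases b using Fin.cases <;> simp [Sym2.eq_swap]
  · ext ⟨e, he⟩
    induction e with | _ i j =>
      simp only [toEdges, succPair, rootPair, LinearMap.coe_mk, AddHom.coe_mk, Sym2.map_mk,
        Sym2.lift_mk, Fin.cases_zero, Fin.cases_succ, w', dif_pos he]
      ring

theorem mem_range_sumPairs_of_toEdges (m : ℕ) (d : Pairs (m + 1) → ℝ)
    (hd : toEdges m d ∈ lineality (completeMatroid m).E) :
    d ∈ LinearMap.range (sumPairs (m + 1)) := by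
  obtain ⟨c, hc⟩ := Submodule.mem_span_singleton.1 hd
  refine ⟨Fin.cases (-c) fun i => d (rootPair i) + c, ?_⟩
  ext ⟨e, he⟩
  induction e with | _ a b =>
    have hab : a ≠ b := by simpa using he
    cases a using Fin.cases with
    | zero =>
      cases b using Fin.cases with
      | zero => exact absurd rfl hab
      | succ j => simp [sumPairs, rootPair]
    | succ i =>
      cases b using Fin.cases with
      | zero => simp [sumPairs, rootPair, Sym2.eq_swap]
      | succ j =>
        have hij : i ≠ j := fun h => hab (by rw [h])
        have := congrFun hc ⟨s(i, j), (⊤ : SimpleGraph (Fin m)).mem_edgeSet.2 hij⟩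
        simp [toEdges, succPair] at this
        simp [sumPairs]
        linarith

/-- The identification `Ψ : Q_n ≅ ℝ^{E(K_{n-1})} / L`.  It sends the class of the curve with a
single bounded edge, of length one, separating the ends in a set `I` not containing the root end
from the other ends, to the class of `ρ_F`, where `F` is the flat of all edges inside `I`. -/
noncomputable def Psi (m : ℕ) : Q (m + 1) ≃ₗ[ℝ] EdgeSpace (⊤ : SimpleGraph (Fin m)) :=
  LinearEquiv.ofBijective
    (Submodule.mapQ _ _ (toEdges m) (by
      rintro _ ⟨x, rfl⟩
      rw [Submodule.mem_comap, toEdges_sumPairs]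
      exact Submodule.smul_mem _ _ (Submodule.mem_span_singleton_self _)))
    ⟨by
      rw [← LinearMap.ker_eq_bot, LinearMap.ker_eq_bot']
      intro q hq
      obtain ⟨d, rfl⟩ := Submodule.mkQ_surjective _ q
      rw [Submodule.mkQ_apply, Submodule.mapQ_apply, Submodule.Quotient.mk_eq_zero] at hq
      rw [Submodule.mkQ_apply, Submodule.Quotient.mk_eq_zero]
      exact mem_range_sumPairs_of_toEdges m d hq,
    by
      intro y
      obtain ⟨w, rfl⟩ := Submodule.mkQ_surjective _ y
      obtain ⟨d, rfl⟩ := toEdges_surjective m w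
      exact ⟨Submodule.mkQ _ d, rfl⟩⟩

/-- The map `ℝ^{E(K_{n-1})} → ℝ^{E(Γ)}` that forgets the coordinates of the edges not in `Γ`. -/
def forget {m : ℕ} (Γ : SimpleGraph (Fin m)) :
    ((completeMatroid m).E → ℝ) →ₗ[ℝ] ((cycleMatroid Γ).E → ℝ) :=
  LinearMap.funLeft ℝ ℝ (Set.inclusion (SimpleGraph.edgeSet_mono (le_top : Γ ≤ ⊤)))

/-- The projection `pr_Γ : ℝ^{E(K_{n-1})} / L → ℝ^{E(Γ)} / L` that forgets the coordinates of the
edges not in `Γ`. -/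
def pr {m : ℕ} (Γ : SimpleGraph (Fin m)) :
    EdgeSpace (⊤ : SimpleGraph (Fin m)) →ₗ[ℝ] EdgeSpace Γ :=
  Submodule.mapQ _ _ (forget Γ) (by
    rw [lineality, Submodule.span_le, Set.singleton_subset_iff]
    exact Submodule.mem_span_singleton_self _)

/-- The projection `pr_Γ` on `Q_n`, through the identification `Ψ`. -/
noncomputable def projection {m : ℕ} (Γ : SimpleGraph (Fin m)) : Q (m + 1) →ₗ[ℝ] EdgeSpace Γ :=
  pr Γ ∘ₗ (Psi m).toLinearMap

end RadialCurves

/-! Everything is read off from the sign-reversed coordinates `u = -w`. By base exchange, `w` lies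
in the Bergman fan exactly when all strict superlevel sets of `-w` are flats (`mem_bergmanFan_iff`).
For a cycle matroid, a flat is an edge set containing every edge of `Γ` whose endpoints it connects.

The coordinates of `Ψ` are minus the Gromov products of the ends based at the root vertex, that is,
minus the radii of last common ancestors. Gromov products in a tree satisfy the ultrametric
inequality `min (u i j) (u j k) ≤ u i k`, and that inequality makes the superlevel sets on `Γ`
flats. This gives the inclusion of the image in `B'(Γ)`.

Conversely, a function on the edges of a connected `Γ` with flat superlevel sets extends to an
ultrametric on the vertices by the bottleneck value of a best connecting path
(`HasFlatLevels.exists_isUltrametric`). The balls of an ultrametric, ordered by inclusion, form a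
rooted tree whose Gromov products recover it up to an additive constant (`ballType_endGromov`), and
the constant dies modulo `L`.

For the cones, both sides have the form `monotoneCone`: all classes of `-(φ ∘ u)` with `φ` monotone.
A chain of flats gives this cone for its depth function (`IsFlatChain.flatCone_eq`). A radially
aligned type gives it for the Gromov products of any realization, because its closed cone allows
exactly the monotone changes of the vertex radii (`RadialType.image_cone`). -/

namespace RadialCurves

open Set

/-! ### Flats, weights and monotone reparametrizations -/

section Levels

variable {α : Type*} {M : Matroid α}

/-- The strict superlevel set `{e | c < u e}` of a function on the ground set. -/
def superlevel (M : Matroid α) (u : M.E → ℝ) (c : ℝ) : Set α := Subtype.val '' {e | c < u e}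

theorem mem_superlevel {u : M.E → ℝ} {c : ℝ} (e : M.E) :
    (e : α) ∈ superlevel M u c ↔ c < u e := by
  simp [superlevel]

theorem superlevel_subset (u : M.E → ℝ) (c : ℝ) : superlevel M u c ⊆ M.E := by
  rintro _ ⟨e, -, rfl⟩
  exact e.2

/-- All strict superlevel sets of `u` are flats. -/
def HasFlatLevels (M : Matroid α) (u : M.E → ℝ) : Prop := ∀ c, M.IsFlat (superlevel M u c)

theorem HasFlatLevels.notMem_closure {u : M.E → ℝ} (hu : HasFlatLevels M u) (e : M.E) :
    (e : α) ∉ M.closure (superlevel M u (u e)) := by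
  rw [(hu _).closure, mem_superlevel]
  exact lt_irrefl _

theorem initialMatroid_loopless_iff [M.Finite] (w : M.E → ℝ) :
    (initialMatroid M w).Loopless ↔ ∀ e ∈ M.E, ∃ B, IsMinBase M w B ∧ e ∈ B := by
  rw [Matroid.loopless_iff_forall_isNonloop]
  have hE : (initialMatroid M w).E = M.E := rfl
  rw [hE]
  refine forall₂_congr fun e he => ?_
  rw [← Matroid.indep_singleton, Matroid.indep_iff]
  simp only [singleton_subset_iff]
  rfl

/-- A vector lies in the Bergman fan exactly when its strict sublevel sets are flats. -/
theorem mem_bergmanFan_iff [M.Finite] (w : M.E → ℝ) :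
    w ∈ bergmanFan M ↔ HasFlatLevels M (-w) := by
  rw [bergmanFan, mem_ofPred_eq, initialMatroid_loopless_iff]
  constructor
  · intro h c
    have hsub := superlevel_subset (-w) c
    rw [Matroid.isFlat_iff_closure_eq]
    refine (M.subset_closure _ hsub).antisymm' fun e he => ?_
    have heE : e ∈ M.E := M.closure_subset_ground _ he
    by_contra hne
    obtain ⟨B, hB, heB⟩ := h e heE
    -- If the superlevel set lay in the closure of `B \ {e}`, so would `e`, against independence of
    -- `B`. An element `f` outside that hyperplane can replace `e`, and it is strictly lighter,
    -- which contradicts minimality.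
    have hH : ¬ superlevel M (-w) c ⊆ M.closure (B \ {e}) := fun hs =>
      hB.1.indep.notMem_closure_sdiff_of_mem heB (M.closure_subset_closure_of_subset_closure hs he)
    obtain ⟨f, hf, hfH⟩ := not_subset.1 hH
    obtain ⟨f, hfc, rfl⟩ := hf
    have hfB : (f : α) ∉ B := fun hfB => by
      by_cases hfe : (f : α) = e
      · exact hne (hfe ▸ (mem_superlevel f).2 hfc)
      · exact hfH (M.mem_closure_of_mem' ⟨hfB, hfe⟩ f.2)
    have hbase := hB.1.exchange_base_of_notMem_closure heB hfH f.2
    have h₁ := hB.2 _ hbase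
    rw [weight_exchange M w B ⟨e, heE⟩ f heB hfB] at h₁
    have h₂ : ¬ c < (-w) ⟨e, heE⟩ := fun hc => hne ((mem_superlevel ⟨e, heE⟩).2 hc)
    have h₃ : c < (-w) f := hfc
    simp only [Pi.neg_apply] at h₂ h₃
    linarith
  · intro h e heE
    obtain ⟨B, hB⟩ := exists_isMinBase M w
    by_cases heB : e ∈ B
    · exact ⟨B, hB, heB⟩
    -- The rest of the fundamental circuit spans `e`, so it cannot sit inside a flat avoiding `e`.
    -- Some `f` of the circuit is therefore at least as heavy as `e`, and exchanging it for `e`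
    -- keeps the weight minimal.
    have hnot : ¬ M.fundCircuit e B \ {e} ⊆ superlevel M (-w) ((-w) ⟨e, heE⟩) := fun hs =>
      h.notMem_closure ⟨e, heE⟩ (M.closure_subset_closure hs
        ((hB.1.fundCircuit_isCircuit heE heB).mem_closure_sdiff_singleton_of_mem
          (M.mem_fundCircuit e B)))
    obtain ⟨f, ⟨hfC, hfe⟩, hf⟩ := not_subset.1 hnot
    have hfe : f ≠ e := hfe
    have hfB : f ∈ B := ((M.fundCircuit_subset_insert e B) hfC).resolve_left hfe
    have hfE : f ∈ M.E := hB.1.subset_ground hfB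
    have hbase : M.IsBase (insert e (B \ {f})) := by
      refine hB.1.exchange_isBase_of_indep heB ?_
      rw [hB.1.indep.mem_fundCircuit_iff (by rwa [hB.1.closure_eq]) heB] at hfC
      rwa [insert_sdiff_singleton_comm hfe.symm]
    refine ⟨_, ⟨hbase, fun B' hB' => ?_⟩, mem_insert _ _⟩
    have h₁ := weight_exchange M w B ⟨f, hfE⟩ ⟨e, heE⟩ hfB heB
    have h₂ := hB.2 B' hB'
    have h₃ : ¬ (-w) ⟨e, heE⟩ < (-w) ⟨f, hfE⟩ := fun hc => hf ((mem_superlevel ⟨f, hfE⟩).2 hc)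
    simp only [Pi.neg_apply] at h₃ h₁
    linarith

/-- The classes of all vectors `-(φ ∘ u)` with `φ` monotone. -/
def monotoneCone (M : Matroid α) (u : M.E → ℝ) : Set ((M.E → ℝ) ⧸ lineality M.E) :=
  {x | ∃ φ : ℝ → ℝ, Monotone φ ∧ x = (lineality M.E).mkQ fun e => -φ (u e)}

theorem mkQ_lineality_eq {x y : M.E → ℝ} (c : ℝ) (h : ∀ e, x e = y e + c) :
    (lineality M.E).mkQ x = (lineality M.E).mkQ y := by
  rw [Submodule.mkQ_apply, Submodule.mkQ_apply, Submodule.Quotient.eq]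
  refine Submodule.mem_span_singleton.2 ⟨c, ?_⟩
  ext e
  simp [h e]

theorem monotoneCone_sub_const (u : M.E → ℝ) (c : ℝ) :
    monotoneCone M (fun e => u e - c) = monotoneCone M u := by
  ext x
  constructor
  · rintro ⟨φ, hφ, rfl⟩
    exact ⟨fun t => φ (t - c), fun s t h => hφ (by linarith), rfl⟩
  · rintro ⟨φ, hφ, rfl⟩
    exact ⟨fun t => φ (t + c), fun s t h => hφ (by linarith), by simp⟩

/-- The cone of a chain of superlevel sets of `u`, one for each value but the greatest one. -/
theorem flatCone_eq_monotoneCone (u : M.E → ℝ) {r : ℕ} (c : Fin (r + 1) → ℝ) (hc : StrictMono c)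
    (hu : ∀ e, u e ∈ range c) (F : Fin r → Set α)
    (hF : ∀ (k : Fin r) (e : M.E), (e : α) ∈ F k ↔ c k.rev.castSucc < u e) :
    flatCone M F = monotoneCone M u := by
  classical
  have hsum : ∀ (a : Fin r → ℝ) (e : M.E), (∑ k, a k • flatRay M (F k)) e =
      -∑ k : Fin r, if c k.castSucc < u e then a k.rev else 0 := by
    intro a e
    rw [Finset.sum_apply, ← Finset.sum_neg_distrib, ← Equiv.sum_comp Fin.revPerm]
    refine Finset.sum_congr rfl fun k _ => ?_
    have := hF k.rev e
    rw [Fin.rev_rev] at this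
    by_cases h : c k.castSucc < u e
    · simp [flatRay, this.2 h, h]
    · simp [flatRay, mt this.1 h, h]
  ext x
  constructor
  · rintro ⟨a, ha, rfl⟩
    -- The coefficients of the rays are the jumps of a step function. The index is reversed because
    -- larger flats belong to lower thresholds.
    refine ⟨fun t => ∑ k : Fin r, if c k.castSucc < t then a k.rev else 0, fun s t hst => ?_,
      congrArg _ (funext fun e => hsum a e)⟩
    refine Finset.sum_le_sum fun k _ => ?_
    by_cases h : c k.castSucc < s
    · simp [h, h.trans_le hst]
    · rw [if_neg h]
      split_ifs
      exacts [ha _, le_rfl]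
  · rintro ⟨φ, hφ, rfl⟩
    -- Conversely the coefficients are the increments of `φ` between consecutive values. They
    -- telescope to `φ (u e) - φ (c 0)`, and the constant `φ (c 0)` vanishes modulo `L`.
    refine ⟨fun k => φ (c k.rev.succ) - φ (c k.rev.castSucc),
      fun k => sub_nonneg.2 (hφ (hc Fin.castSucc_lt_succ).le),
      mkQ_lineality_eq (-φ (c 0)) fun e => ?_⟩
    rw [hsum]
    obtain ⟨s, hs⟩ := hu e
    rw [← hs]
    simp only [hc.lt_iff_lt, Fin.rev_rev]
    have key : ∀ s : Fin (r + 1), (∑ k : Fin r,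
        if k.castSucc < s then φ (c k.succ) - φ (c k.castSucc) else 0) = φ (c s) - φ (c 0) := by
      intro s
      induction s using Fin.induction with
      | zero => simp
      | succ j ih =>
        have h : ∀ k : Fin r, (if k.castSucc < j.succ then φ (c k.succ) - φ (c k.castSucc) else 0) =
            (if k.castSucc < j.castSucc then φ (c k.succ) - φ (c k.castSucc) else 0) +
            if k = j then φ (c k.succ) - φ (c k.castSucc) else 0 := by
          intro k
          rcases lt_trichotomy k j with h | rfl | h
          · have h' : k.castSucc < j.succ := by
              rw [Fin.lt_def] at *; simp; omega
            simp [h, h', h.ne]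
          · simp
          · have h' : ¬ k.castSucc < j.succ := by
              rw [Fin.lt_def] at *; simp; omega
            simp [h.ne', h', h.not_gt]
        rw [Finset.sum_congr rfl fun k _ => h k, Finset.sum_add_distrib, ih]
        simp
    rw [key]
    ring

/-- Sort the values of `u` as `c 0 < ⋯ < c r` and cut at all but the greatest, whose superlevel set
is empty. Every value is attained, so the inclusions are strict, the sets are nonempty, and the
minimum keeps even the largest set proper. -/
theorem HasFlatLevels.monotoneCone_mem_bergmanCones [M.Finite] [Nonempty M.E] {u : M.E → ℝ}
    (hu : HasFlatLevels M u) : monotoneCone M u ∈ bergmanCones M := by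
  classical
  have : Finite M.E := M.ground_finite.to_subtype
  have := Fintype.ofFinite M.E
  let s : Finset ℝ := Finset.univ.image u
  have hs : 0 < s.card := Finset.card_pos.2 (Finset.univ_nonempty.image u)
  obtain ⟨r, hr⟩ := Nat.exists_eq_succ_of_ne_zero hs.ne'
  let c : Fin (r + 1) → ℝ := s.orderEmbOfFin hr
  have hc : StrictMono c := (s.orderEmbOfFin hr).strictMono
  have hrange : range c = s := s.range_orderEmbOfFin hr
  have huc : ∀ e, u e ∈ range c := fun e => by
    rw [hrange]
    exact Finset.mem_coe.2 (Finset.mem_image_of_mem u (Finset.mem_univ e))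
  have hcu : ∀ k, ∃ e, u e = c k := fun k => by
    have : c k ∈ (s : Set ℝ) := hrange ▸ mem_range_self k
    simpa [s] using this
  refine ⟨r, fun k => superlevel M u (c k.rev.castSucc), ⟨fun k => hu _, fun k l hkl => ?_,
    fun k => ?_, fun k => ?_⟩,
    (flatCone_eq_monotoneCone u c hc huc _ fun k e => mem_superlevel e).symm⟩
  · have hlt : c l.rev.castSucc < c k.rev.castSucc := hc (by simpa using hkl)
    refine ⟨image_mono fun e he => hlt.trans he, fun hsub => ?_⟩
    obtain ⟨e, he⟩ := hcu k.rev.castSucc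
    have := (mem_superlevel e).1 (hsub ((mem_superlevel e).2 (he ▸ hlt)))
    exact this.ne' he
  · obtain ⟨e, he⟩ := hcu k.rev.succ
    exact ⟨e, (mem_superlevel e).2 (he ▸ hc Fin.castSucc_lt_succ)⟩
  · intro heq
    obtain ⟨e, he⟩ := hcu k.rev.castSucc
    have := (mem_superlevel (u := u) (c := c k.rev.castSucc) e).1 (heq.symm ▸ e.2)
    exact this.ne' he

/-- The number of members of a chain of sets that contain a given element. -/
noncomputable def depth (M : Matroid α) {r : ℕ} (F : Fin r → Set α) (e : M.E) : ℕ :=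
  {k | (e : α) ∈ F k}.ncard

theorem depth_le {r : ℕ} (F : Fin r → Set α) (e : M.E) : depth M F e ≤ r := by
  refine (ncard_le_ncard (subset_univ _)).trans ?_
  simp [ncard_univ]

/-- The members of the chain containing `e` form a final segment of the indices, so their number
determines them. -/
theorem IsFlatChain.mem_iff {r : ℕ} {F : Fin r → Set α} (hF : IsFlatChain M F) (k : Fin r)
    (e : M.E) : (e : α) ∈ F k ↔ (k.rev : ℕ) < depth M F e := by
  have hcard : ∀ k : Fin r, (Ici k).ncard = r - k ∧ (Ioi k).ncard = r - 1 - k := fun k => by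
    rw [← Finset.coe_Ici, ← Finset.coe_Ioi, ncard_coe_finset, ncard_coe_finset, Fin.card_Ici,
      Fin.card_Ioi]
    exact ⟨rfl, rfl⟩
  have hk := k.2
  rw [Fin.val_rev]
  constructor
  · intro he
    have : (Ici k).ncard ≤ depth M F e :=
      ncard_le_ncard fun l hl => hF.strictMono.monotone hl he
    rw [(hcard k).1] at this
    omega
  · intro hlt
    by_contra he
    have : depth M F e ≤ (Ioi k).ncard :=
      ncard_le_ncard fun l hl => lt_of_not_ge fun hlk => he (hF.strictMono.monotone hlk hl)
    rw [(hcard k).2] at this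
    omega

theorem IsFlatChain.flatCone_eq {r : ℕ} {F : Fin r → Set α} (hF : IsFlatChain M F) :
    flatCone M F = monotoneCone M fun e => (depth M F e : ℝ) := by
  have hc : StrictMono fun k : Fin (r + 1) => ((k : ℕ) : ℝ) := fun k l h => Nat.cast_lt.2 h
  refine flatCone_eq_monotoneCone _ _ hc (fun e => ?_) F fun k e => ?_
  · exact ⟨⟨depth M F e, Nat.lt_succ_of_le (depth_le F e)⟩, rfl⟩
  · rw [hF.mem_iff, Nat.cast_lt, Fin.val_castSucc]

/-- The superlevel sets of the depth are the ground set, the members of the chain, and the empty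
set. The last is a flat only in the absence of loops, hence `h₀`. -/
theorem IsFlatChain.hasFlatLevels {r : ℕ} {F : Fin r → Set α} (hF : IsFlatChain M F)
    (h₀ : M.IsFlat ∅) : HasFlatLevels M fun e => (depth M F e : ℝ) := by
  intro c
  by_cases hc : c < 0
  · convert! M.ground_isFlat
    refine (superlevel_subset _ _).antisymm fun e he => ?_
    exact (mem_superlevel ⟨e, he⟩).2 (hc.trans_le (Nat.cast_nonneg _))
  have hfloor : ∀ e, c < (depth M F e : ℝ) ↔ ⌊c⌋₊ < depth M F e := fun e =>
    (Nat.floor_lt (not_lt.1 hc)).symm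
  by_cases hr : ⌊c⌋₊ < r
  · convert! hF.isFlat (Fin.rev ⟨_, hr⟩) using 1
    ext e
    constructor
    · rintro ⟨e, he, rfl⟩
      rw [hF.mem_iff, Fin.rev_rev]
      exact (hfloor e).1 he
    · intro he
      have heE := (hF.isFlat _).subset_ground he
      rw [hF.mem_iff _ ⟨e, heE⟩, Fin.rev_rev] at he
      exact (mem_superlevel ⟨e, heE⟩).2 ((hfloor _).2 he)
  · convert! h₀
    refine eq_empty_of_forall_notMem ?_
    rintro _ ⟨e, he, rfl⟩
    have h₁ := (hfloor e).1 he
    have := depth_le F e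
    omega

end Levels

/-! ### Flats of the cycle matroid and ultrametrics -/

section Ultrametric

variable {V : Type*}

/-- A symmetric function with `u i k ≥ min (u i j) (u j k)`. -/
structure IsUltrametric (u : V → V → ℝ) : Prop where
  symm : ∀ i j, u i j = u j i
  min_le : ∀ i j k, min (u i j) (u j k) ≤ u i k

/-- The inequality propagates along a walk. The last edge is treated apart because nothing is
assumed about the values on the diagonal beyond the axioms. -/
theorem IsUltrametric.lt_of_reachable {u : V → V → ℝ} (hu : IsUltrametric u) {X : Set (Sym2 V)} {c : ℝ}
    (hX : ∀ a b, s(a, b) ∈ X → c < u a b) {i j : V} (hij : i ≠ j)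
    (h : (SimpleGraph.fromEdgeSet X).Reachable i j) : c < u i j := by
  obtain ⟨p⟩ := h
  induction p with
  | nil => exact (hij rfl).elim
  | @cons a b d hab _ ih =>
    have h₁ : c < u a b := hX a b ((SimpleGraph.fromEdgeSet_adj X).1 hab).1
    by_cases hbd : b = d
    · exact hbd ▸ h₁
    · exact (lt_min h₁ (ih hbd)).trans_le (hu.min_le a b d)

end Ultrametric

/-! ### Flats of the cycle matroid as connectivity-closed edge sets. -/

section CycleFlats

variable {V : Type*} {Γ : SimpleGraph V}

theorem isForest_insert_iff {I : Set (Sym2 V)} (hI : IsForest Γ I) {i j : V} (hij : Γ.Adj i j)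
    (hn : s(i, j) ∉ I) :
    IsForest Γ (insert s(i, j) I) ↔ ¬ (SimpleGraph.fromEdgeSet I).Reachable i j := by
  have hgraph : SimpleGraph.fromEdgeSet (insert s(i, j) I) =
      SimpleGraph.fromEdgeSet I ⊔ SimpleGraph.edge i j := by
    rw [SimpleGraph.edge, ← SimpleGraph.fromEdgeSet_union, union_comm, singleton_union]
  have hadj : ¬ (SimpleGraph.fromEdgeSet I).Adj i j := fun h =>
    hn ((SimpleGraph.fromEdgeSet_adj I).1 h).1
  rw [IsForest, hgraph, SimpleGraph.isAcyclic_sup_fromEdgeSet_iff]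
  constructor
  · rintro ⟨-, -, h⟩ hr
    rcases h hr with h | h
    exacts [hij.ne h, hadj h]
  · intro h
    exact ⟨insert_subset hij hI.1, hI.2, fun hr => (h hr).elim⟩

variable [Finite V]

theorem cycleMatroid_indep_iff {I : Set (Sym2 V)} :
    (cycleMatroid Γ).Indep I ↔ IsForest Γ I := Iff.rfl

/-- An edge of `X` joining two components of the forest `I` could be added to it, against
maximality. -/
theorem reachable_of_isBasis {I X : Set (Sym2 V)} (hI : (cycleMatroid Γ).IsBasis I X) {i j : V}
    (h : (SimpleGraph.fromEdgeSet X).Reachable i j) :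
    (SimpleGraph.fromEdgeSet I).Reachable i j := by
  obtain ⟨p⟩ := h
  induction p with
  | nil => exact SimpleGraph.Reachable.refl _
  | @cons a b _ hab _ ih =>
    refine SimpleGraph.Reachable.trans ?_ ih
    rw [SimpleGraph.fromEdgeSet_adj] at hab
    by_cases hm : s(a, b) ∈ I
    · exact SimpleGraph.Adj.reachable ((SimpleGraph.fromEdgeSet_adj I).2 ⟨hm, hab.2⟩)
    by_contra hr
    have hadj : Γ.Adj a b := hI.subset_ground hab.1
    have := (isForest_insert_iff hI.indep hadj hm).2 hr
    exact hm (hI.mem_of_insert_indep hab.1 this)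

/-- The flats of the cycle matroid are the sets of edges that contain every edge of the graph whose
endpoints they connect. -/
theorem isFlat_cycleMatroid_iff {F : Set (Sym2 V)} (hF : F ⊆ Γ.edgeSet) :
    (cycleMatroid Γ).IsFlat F ↔
      ∀ i j, Γ.Adj i j → (SimpleGraph.fromEdgeSet F).Reachable i j → s(i, j) ∈ F := by
  obtain ⟨I, hI⟩ := (cycleMatroid Γ).exists_isBasis F hF
  rw [Matroid.isFlat_iff_closure_eq, ← hI.closure_eq_closure]
  have hcl : ∀ i j, Γ.Adj i j → s(i, j) ∉ I →
      (s(i, j) ∈ (cycleMatroid Γ).closure I ↔ (SimpleGraph.fromEdgeSet I).Reachable i j) := by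
    intro i j hij hn
    have hE : s(i, j) ∈ (cycleMatroid Γ).E := hij
    rw [← not_iff_not, hI.indep.notMem_closure_iff_of_notMem hn hE, cycleMatroid_indep_iff,
      isForest_insert_iff hI.indep hij hn]
  constructor
  · intro h i j hij hr
    by_cases hn : s(i, j) ∈ I
    · exact hI.subset hn
    rw [← h, hcl i j hij hn]
    exact reachable_of_isBasis hI hr
  · intro h
    refine subset_antisymm (fun e he => ?_) hI.subset_closure
    have heE := (cycleMatroid Γ).closure_subset_ground _ he
    induction e with | _ i j =>
    have hij : Γ.Adj i j := heE
    by_cases hn : s(i, j) ∈ I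
    · exact hI.subset hn
    exact h i j hij (((hcl i j hij hn).1 he).mono (SimpleGraph.fromEdgeSet_mono hI.subset))

theorem isFlat_empty_cycleMatroid : (cycleMatroid Γ).IsFlat ∅ := by
  rw [isFlat_cycleMatroid_iff (empty_subset _)]
  intro i j hij hr
  rw [SimpleGraph.fromEdgeSet_empty, SimpleGraph.reachable_bot] at hr
  exact (hij.ne hr).elim

/-- The restriction of a symmetric function of two vertices to the edges of `Γ`. -/
def restrict (Γ : SimpleGraph V) (u : V → V → ℝ) (hu : ∀ i j, u i j = u j i) :
    (cycleMatroid Γ).E → ℝ :=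
  fun e => Sym2.lift ⟨u, hu⟩ e.1

theorem IsUltrametric.hasFlatLevels {u : V → V → ℝ} (hu : IsUltrametric u) (Γ : SimpleGraph V) :
    HasFlatLevels (cycleMatroid Γ) (restrict Γ u hu.symm) := by
  intro c
  rw [isFlat_cycleMatroid_iff (superlevel_subset _ _)]
  intro i j hij hr
  refine (mem_superlevel (M := cycleMatroid Γ) ⟨s(i, j), hij⟩).2 (hu.lt_of_reachable ?_ hij.ne hr)
  rintro a b ⟨⟨e, he⟩, hc, rfl⟩
  exact hc

/-- A function on the edges of a connected graph whose superlevel sets are flats extends to an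
ultrametric on the vertices. -/
theorem HasFlatLevels.exists_isUltrametric (hΓ : Γ.Connected) [Nonempty (cycleMatroid Γ).E]
    {R : (cycleMatroid Γ).E → ℝ} (hR : HasFlatLevels (cycleMatroid Γ) R) :
    ∃ (u : V → V → ℝ) (hu : IsUltrametric u), restrict Γ u hu.symm = R := by
  classical
  have : Finite (cycleMatroid Γ).E := (cycleMatroid Γ).ground_finite.to_subtype
  let X : ℝ → Set (Sym2 V) := fun c => Subtype.val '' {e | c ≤ R e}
  have hX : ∀ {c d : ℝ}, c ≤ d → X d ⊆ X c := fun h => image_mono fun e he => h.trans he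
  -- The thresholds at which `i` and `j` are still connected. The largest one, the bottleneck value,
  -- is the ultrametric; restricting to values of `R` keeps the set finite, so the supremum is
  -- attained.
  let S : V → V → Set ℝ := fun i j => {c ∈ range R | (SimpleGraph.fromEdgeSet (X c)).Reachable i j}
  have hfin : ∀ i j, (S i j).Finite := fun i j => (finite_range R).subset (sep_subset _ _)
  obtain ⟨e₀, he₀⟩ := Finite.exists_min R
  -- At the least value of `R` all edges of `Γ` are present, and connectedness of `Γ` applies.
  have hne : ∀ i j, (S i j).Nonempty := by
    refine fun i j => ⟨R e₀, mem_range_self e₀, ?_⟩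
    have : X (R e₀) = Γ.edgeSet :=
      subset_antisymm (by rintro _ ⟨e, -, rfl⟩; exact e.2)
        fun e he => ⟨⟨e, he⟩, he₀ _, rfl⟩
    rw [this, SimpleGraph.fromEdgeSet_edgeSet]
    exact hΓ.preconnected i j
  let u : V → V → ℝ := fun i j => sSup (S i j)
  have hmem : ∀ i j, u i j ∈ S i j := fun i j => (hne i j).csSup_mem (hfin i j)
  have hle : ∀ {i j c}, c ∈ S i j → c ≤ u i j := fun {i j c} h => le_csSup (hfin i j).bddAbove h
  have hreach : ∀ {i j c}, c ≤ u i j → (SimpleGraph.fromEdgeSet (X c)).Reachable i j :=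
    fun {i j c} h => (hmem i j).2.mono (SimpleGraph.fromEdgeSet_mono (hX h))
  have hu : IsUltrametric u := by
    refine ⟨fun i j => ?_, fun i j k => hle ⟨?_, ?_⟩⟩
    · simp only [u, S, SimpleGraph.reachable_comm]
    · rcases min_choice (u i j) (u j k) with h | h <;> rw [h]
      exacts [(hmem i j).1, (hmem j k).1]
    · exact (hreach (min_le_left _ _)).trans (hreach (min_le_right _ _))
  refine ⟨u, hu, funext ?_⟩
  rintro ⟨e, he⟩
  induction e with | _ i j =>
  have hij : Γ.Adj i j := he
  change u i j = R ⟨s(i, j), he⟩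
  refine le_antisymm (le_of_forall_lt fun c hc => ?_) (hle ⟨mem_range_self _, ?_⟩)
  · have hflat := (isFlat_cycleMatroid_iff (superlevel_subset R c)).1 (hR c) i j hij
    refine (mem_superlevel (M := cycleMatroid Γ) ⟨s(i, j), he⟩).1 (hflat ?_)
    refine (hmem i j).2.mono (SimpleGraph.fromEdgeSet_mono (image_mono fun e he => ?_))
    exact hc.trans_le he
  · exact SimpleGraph.Adj.reachable
      ((SimpleGraph.fromEdgeSet_adj _).2 ⟨⟨⟨_, he⟩, le_refl (R _), rfl⟩, hij.ne⟩)

end CycleFlats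

/-! ### Distances in trees -/

theorem isPath_append {V : Type*} {G : SimpleGraph V} {a b c : V} {p : G.Walk a b} {q : G.Walk b c}
    (hp : p.IsPath) (hq : q.IsPath) (h : ∀ x ∈ p.support, x ∈ q.support → x = b) :
    (p.append q).IsPath := by
  rw [SimpleGraph.Walk.isPath_def, SimpleGraph.Walk.support_append, List.nodup_append']
  refine ⟨hp.support_nodup, hq.support_nodup.tail, fun x hx hx' => ?_⟩
  obtain rfl := h x hx (List.mem_of_mem_tail hx')
  have := hq.support_nodup
  rw [← SimpleGraph.Walk.cons_tail_support, List.nodup_cons] at this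
  exact this.1 hx'

/-- The part of a path up to the first vertex of a set that its end belongs to. -/
theorem exists_first_mem {V : Type*} {G : SimpleGraph V} (S : Set V) {a b : V} (p : G.Walk a b)
    (hp : p.IsPath) (hb : b ∈ S) :
    ∃ c ∈ S, ∃ q : G.Walk a c, q.IsPath ∧ (∀ x ∈ q.support, x ∈ p.support) ∧
      ∀ x ∈ q.support, x ∈ S → x = c := by
  induction p with
  | nil => exact ⟨_, hb, SimpleGraph.Walk.nil, by simp, by simp, by simp⟩
  | @cons a a' b h p ih =>
    by_cases ha : a ∈ S
    · exact ⟨a, ha, SimpleGraph.Walk.nil, by simp, by simp, by simp⟩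
    rw [SimpleGraph.Walk.cons_isPath_iff] at hp
    obtain ⟨c, hc, q, hq, hqp, hqS⟩ := ih hp.1 hb
    refine ⟨c, hc, SimpleGraph.Walk.cons h q, ?_, ?_, ?_⟩
    · rw [SimpleGraph.Walk.cons_isPath_iff]
      exact ⟨hq, fun haq => hp.2 (hqp a haq)⟩
    · intro x hx
      rw [SimpleGraph.Walk.support_cons, List.mem_cons] at hx ⊢
      exact hx.imp_right (hqp x)
    · intro x hx hxS
      rw [SimpleGraph.Walk.support_cons, List.mem_cons] at hx
      rcases hx with rfl | hx
      · exact (ha hxS).elim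
      · exact hqS x hx hxS

/-! ### Gromov products and ancestors in a rooted tree. -/

namespace CombType

variable {m : ℕ} (T : CombType m)

theorem path_isPath (u v : T.V) : (T.path u v).IsPath :=
  (T.isTree.existsUnique_path u v).choose_spec.1

theorem eq_path {u v : T.V} {p : T.tree.Walk u v} (hp : p.IsPath) : p = T.path u v :=
  (T.isTree.existsUnique_path u v).choose_spec.2 p hp

theorem dist_nonneg {ℓ : Sym2 T.V → ℝ} (hℓ : ∀ e ∈ T.tree.edgeSet, 0 ≤ ℓ e) (u v : T.V) :
    0 ≤ T.dist ℓ u v := by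
  refine List.sum_nonneg fun x hx => ?_
  obtain ⟨e, he, rfl⟩ := List.mem_map.1 hx
  exact hℓ e (SimpleGraph.Walk.edges_subset_edgeSet _ he)

theorem path_append {u v w : T.V} (h : v ∈ (T.path u w).support) :
    (T.path u v).append (T.path v w) = T.path u w := by
  classical
  have hspec := (T.path u w).take_spec h
  rwa [T.eq_path ((T.path_isPath u w).takeUntil h), T.eq_path ((T.path_isPath u w).dropUntil h)]
    at hspec

theorem dist_add (ℓ : Sym2 T.V → ℝ) {u v w : T.V} (h : v ∈ (T.path u w).support) :
    T.dist ℓ u w = T.dist ℓ u v + T.dist ℓ v w := by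
  rw [dist, ← T.path_append h, SimpleGraph.Walk.edges_append, List.map_append, List.sum_append]
  rfl

/-- `a` lies on the path from the root to `b`. -/
def IsAncestor (a b : T.V) : Prop := a ∈ (T.path T.root b).support

variable {T}

theorem IsAncestor.trans {a b c : T.V} (hab : T.IsAncestor a b) (hbc : T.IsAncestor b c) :
    T.IsAncestor a c := by
  rw [IsAncestor, ← T.path_append hbc, SimpleGraph.Walk.mem_support_append_iff]
  exact Or.inl hab

theorem IsAncestor.total {a b c : T.V} (hac : T.IsAncestor a c) (hbc : T.IsAncestor b c) :
    T.IsAncestor a b ∨ T.IsAncestor b a := by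
  have h := hac
  rw [IsAncestor, ← T.path_append hbc, SimpleGraph.Walk.mem_support_append_iff] at h
  refine h.imp id fun h => ?_
  have hp := T.path_isPath T.root c
  rw [← T.path_append hbc, ← T.path_append h, SimpleGraph.Walk.append_assoc] at hp
  rw [IsAncestor, ← T.eq_path hp.of_append_left, SimpleGraph.Walk.mem_support_append_iff]
  exact Or.inl (SimpleGraph.Walk.end_mem_support _)

theorem IsAncestor.dist_eq {a b : T.V} (h : T.IsAncestor a b) (ℓ : Sym2 T.V → ℝ) :
    T.dist ℓ T.root b = T.dist ℓ T.root a + T.dist ℓ a b := T.dist_add ℓ h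

variable (T)

/-- The Gromov product of two vertices with respect to the root. -/
noncomputable def gromov (ℓ : Sym2 T.V → ℝ) (a b : T.V) : ℝ :=
  (T.dist ℓ T.root a + T.dist ℓ T.root b - T.dist ℓ a b) / 2

theorem gromov_comm (ℓ : Sym2 T.V → ℝ) (a b : T.V) : T.gromov ℓ a b = T.gromov ℓ b a := by
  rw [gromov, gromov, T.dist_comm ℓ a b]
  ring

/-- Walk from `b` towards `r` until the path from `r` to `a` is first met. Gluing there creates no
repeated vertex, so uniqueness of paths identifies both concatenations with tree paths. -/
theorem exists_median (r a b : T.V) : ∃ c, c ∈ (T.path r a).support ∧ c ∈ (T.path r b).support ∧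
    c ∈ (T.path a b).support := by
  classical
  obtain ⟨c, hc, q, hq, -, hqS⟩ := exists_first_mem {x | x ∈ (T.path r a).support}
    (T.path b r) (T.path_isPath b r) (SimpleGraph.Walk.start_mem_support _)
  have hc' : c ∈ (T.path r a).support := hc
  have h₁ : ((T.path r c).append q.reverse).IsPath := by
    refine isPath_append (T.path_isPath r c) hq.reverse fun x hx hx' => ?_
    refine hqS x (by simpa using hx') ?_
    have : x ∈ ((T.path r c).append (T.path c a)).support :=
      (SimpleGraph.Walk.mem_support_append_iff _ _).2 (Or.inl hx)
    rwa [T.path_append hc'] at this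
  have h₂ : ((T.path c a).reverse.append q.reverse).IsPath := by
    refine isPath_append (T.path_isPath c a).reverse hq.reverse fun x hx hx' => ?_
    refine hqS x (by simpa using hx') ?_
    have : x ∈ ((T.path r c).append (T.path c a)).support :=
      (SimpleGraph.Walk.mem_support_append_iff _ _).2 (Or.inr (by simpa using hx))
    rwa [T.path_append hc'] at this
  refine ⟨c, hc', ?_, ?_⟩
  · rw [← T.eq_path h₁, SimpleGraph.Walk.mem_support_append_iff]
    exact Or.inl (SimpleGraph.Walk.end_mem_support _)
  · rw [← T.eq_path h₂, SimpleGraph.Walk.mem_support_append_iff]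
    exact Or.inl (SimpleGraph.Walk.end_mem_support _)

/-- The last common ancestor of two vertices; its radius is their Gromov product. -/
theorem exists_meet (a b : T.V) : ∃ c, T.IsAncestor c a ∧ T.IsAncestor c b ∧
    ∀ ℓ, T.gromov ℓ a b = T.dist ℓ T.root c := by
  obtain ⟨c, hca, hcb, hc⟩ := T.exists_median T.root a b
  refine ⟨c, hca, hcb, fun ℓ => ?_⟩
  rw [gromov, T.dist_add ℓ hca, T.dist_add ℓ hcb, T.dist_add ℓ hc, T.dist_comm ℓ a c]
  ring

theorem dist_triangle {ℓ : Sym2 T.V → ℝ} (hℓ : ∀ e ∈ T.tree.edgeSet, 0 ≤ ℓ e) (a b c : T.V) :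
    T.dist ℓ a c ≤ T.dist ℓ a b + T.dist ℓ b c := by
  obtain ⟨d, h₁, h₂, h₃⟩ := T.exists_median b a c
  rw [T.dist_comm ℓ a b, T.dist_add ℓ h₁, T.dist_add ℓ h₂, T.dist_add ℓ h₃, T.dist_comm ℓ a d]
  have := T.dist_nonneg hℓ b d
  linarith

variable {T}

theorem IsAncestor.le_gromov {ℓ : Sym2 T.V → ℝ} (hℓ : ∀ e ∈ T.tree.edgeSet, 0 ≤ ℓ e) {a b c : T.V}
    (ha : T.IsAncestor c a) (hb : T.IsAncestor c b) : T.dist ℓ T.root c ≤ T.gromov ℓ a b := by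
  rw [gromov, ha.dist_eq ℓ, hb.dist_eq ℓ]
  have := T.dist_triangle hℓ a c b
  rw [T.dist_comm ℓ a c] at this
  linarith

variable (T)

/-- The meets of `a, b` and of `b, c` are both ancestors of `b`, hence comparable. The one nearer
the root is a common ancestor of `a` and `c`, so its radius bounds their Gromov product from below.
-/
theorem gromov_isUltrametric {ℓ : Sym2 T.V → ℝ} (hℓ : ∀ e ∈ T.tree.edgeSet, 0 ≤ ℓ e) :
    IsUltrametric (T.gromov ℓ) := by
  refine ⟨T.gromov_comm ℓ, fun a b c => ?_⟩
  obtain ⟨x, hxa, hxb, hx⟩ := T.exists_meet a b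
  obtain ⟨y, hyb, hyc, hy⟩ := T.exists_meet b c
  rw [hx ℓ, hy ℓ]
  rcases hxb.total hyb with h | h
  · exact (min_le_left _ _).trans (hxa.le_gromov hℓ (h.trans hyc))
  · exact (min_le_right _ _).trans ((h.trans hxa).le_gromov hℓ hyc)

/-- The Gromov products of the ends other than the root end. -/
noncomputable def endGromov (ℓ : Sym2 T.V → ℝ) (i j : Fin m) : ℝ :=
  T.gromov ℓ (T.mark i.succ) (T.mark j.succ)

theorem endGromov_isUltrametric {ℓ : Sym2 T.V → ℝ} (hℓ : ∀ e ∈ T.tree.edgeSet, 0 ≤ ℓ e) :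
    IsUltrametric (T.endGromov ℓ) :=
  ⟨fun _ _ => (T.gromov_isUltrametric hℓ).symm _ _,
    fun _ _ _ => (T.gromov_isUltrametric hℓ).min_le _ _ _⟩

theorem endGromov_comm (ℓ : Sym2 T.V → ℝ) (i j : Fin m) :
    T.endGromov ℓ i j = T.endGromov ℓ j i := T.gromov_comm ℓ _ _

theorem projection_point (Γ : SimpleGraph (Fin m)) (ℓ : Sym2 T.V → ℝ) :
    projection Γ (T.point ℓ) = (lineality (cycleMatroid Γ).E).mkQ
      fun e => -restrict Γ (T.endGromov ℓ) (T.endGromov_comm ℓ) e := by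
  change (lineality (cycleMatroid Γ).E).mkQ (forget Γ (toEdges m (T.distVector ℓ))) = _
  congr 1
  ext ⟨e, he⟩
  induction e with | _ i j =>
  change (T.dist ℓ (T.mark i.succ) (T.mark j.succ) - (T.dist ℓ (T.mark 0) (T.mark i.succ) +
    T.dist ℓ (T.mark 0) (T.mark j.succ))) / 2 = -T.gromov ℓ (T.mark i.succ) (T.mark j.succ)
  rw [gromov, root]
  ring

/-- Lengths for which the radii of the vertices are prescribed. -/
noncomputable def lengthOf (ρ : T.V → ℝ) (e : Sym2 T.V) : ℝ :=
  Sym2.lift ⟨fun a b => |ρ a - ρ b|, fun _ _ => abs_sub_comm _ _⟩ e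

theorem lengthOf_nonneg (ρ : T.V → ℝ) (e : Sym2 T.V) : 0 ≤ T.lengthOf ρ e := by
  induction e with | _ a b => exact abs_nonneg _

/-- Since `ρ` does not decrease away from the root, the absolute values open up and the sum along
the path telescopes. -/
theorem dist_lengthOf (ρ : T.V → ℝ)
    (hρ : ∀ a b, T.tree.Adj a b → T.IsAncestor a b → ρ a ≤ ρ b) (v : T.V) :
    T.dist (T.lengthOf ρ) T.root v = ρ v - ρ T.root := by
  have key : ∀ (a v : T.V) (p : T.tree.Walk a v), p.IsPath → a = T.root →
      (p.edges.map (T.lengthOf ρ)).sum = ρ v - ρ a := by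
    intro a v p
    induction p using SimpleGraph.Walk.concatRec with
    | Hnil => simp
    | @Hconcat a b c p h ih =>
      rintro hp rfl
      have hab : T.IsAncestor b c := by
        rw [IsAncestor, ← T.eq_path hp, SimpleGraph.Walk.support_concat]
        simp
      have hb := hρ b c h hab
      rw [SimpleGraph.Walk.concat_isPath_iff] at hp
      rw [SimpleGraph.Walk.edges_concat, List.concat_eq_append, List.map_append, List.sum_append,
        ih hp.1 rfl]
      have : T.lengthOf ρ s(b, c) = ρ c - ρ b :=
        (abs_sub_comm _ _).trans (abs_of_nonneg (sub_nonneg.2 hb))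
      simp [this]
  exact key _ _ _ (T.path_isPath T.root v) rfl

end CombType

/-- The image of a cone of `M_{0,n}^rad` in terms of the Gromov products of a realization. -/
theorem RadialType.image_cone {m : ℕ} (T : RadialType m) (Γ : SimpleGraph (Fin m))
    {ℓ : Sym2 T.V → ℝ} (hℓ : ∀ e ∈ T.tree.edgeSet, 0 < ℓ e) (hle : ∀ u v, T.le u v ↔
      T.toCombType.dist ℓ T.root u ≤ T.toCombType.dist ℓ T.root v) :
    projection Γ '' T.cone = monotoneCone (cycleMatroid Γ)
      (restrict Γ (T.endGromov ℓ) (T.endGromov_comm ℓ)) := by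
  have := T.finite
  choose meet hmeet using T.exists_meet
  have hradius : ∀ ℓ' i j, T.endGromov ℓ' i j =
      T.dist ℓ' T.root (meet (T.mark i.succ) (T.mark j.succ)) := fun ℓ' i j => (hmeet _ _).2.2 ℓ'
  ext x
  constructor
  · rintro ⟨_, ⟨ℓ', hℓ', hmono, rfl⟩, rfl⟩
    -- Vertices with equal `ℓ`-radius are equivalent for the weak ordering, so their `ℓ'`-radii
    -- agree. The set is thus a singleton at each attained radius; other values of `f` play no role.
    let f : ℝ → ℝ := fun t => sSup {s | ∃ v, T.dist ℓ T.root v = t ∧ T.dist ℓ' T.root v = s}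
    have hf : ∀ v, f (T.dist ℓ T.root v) = T.dist ℓ' T.root v := by
      intro v
      have : {s | ∃ w, T.dist ℓ T.root w = T.dist ℓ T.root v ∧ T.dist ℓ' T.root w = s} =
          {T.dist ℓ' T.root v} := by
        refine Subset.antisymm ?_ (singleton_subset_iff.2 ⟨v, rfl, rfl⟩)
        rintro _ ⟨w, hw, rfl⟩
        exact le_antisymm (hmono _ _ ((hle _ _).2 hw.le)) (hmono _ _ ((hle _ _).2 hw.ge))
      simp only [f, this, csSup_singleton]
    have hmonoOn : MonotoneOn f (range fun v => T.dist ℓ T.root v) := by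
      rintro _ ⟨v, rfl⟩ _ ⟨w, rfl⟩ h
      rw [hf, hf]
      exact hmono _ _ ((hle _ _).2 h)
    have hfin : (f '' range fun v => T.dist ℓ T.root v).Finite := (finite_range _).image f
    obtain ⟨φ, hφ, hφf⟩ := hmonoOn.exists_monotone_extension hfin.bddBelow hfin.bddAbove
    refine ⟨φ, hφ, ?_⟩
    rw [CombType.projection_point]
    congr 1
    ext ⟨e, he⟩
    induction e with | _ i j =>
    change -T.endGromov ℓ' i j = -φ (T.endGromov ℓ i j)
    rw [hradius, hradius, ← hφf (mem_range_self _), hf]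
  · rintro ⟨φ, hφ, rfl⟩
    -- The new radii are the old ones moved by `φ`. Edges on which `φ` is constant get length zero,
    -- which the closed cone permits.
    let ρ : T.V → ℝ := fun v => φ (T.dist ℓ T.root v)
    have hρ : ∀ v, T.dist (T.lengthOf ρ) T.root v = ρ v - ρ T.root := by
      refine T.dist_lengthOf ρ fun a b _ h => hφ ?_
      rw [h.dist_eq ℓ]
      have := T.dist_nonneg (fun e he => (hℓ e he).le) a b
      linarith
    refine ⟨_, ⟨T.lengthOf ρ, fun e _ => T.lengthOf_nonneg ρ e, fun u v huv => ?_, rfl⟩, ?_⟩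
    · have := hφ ((hle u v).1 huv)
      rw [hρ, hρ]
      exact sub_le_sub_right this _
    · rw [CombType.projection_point]
      refine mkQ_lineality_eq (ρ T.root) ?_
      rintro ⟨e, he⟩
      induction e with | _ i j =>
      change -T.endGromov (T.lengthOf ρ) i j = -φ (T.endGromov ℓ i j) + ρ T.root
      rw [hradius, hradius, hρ]
      ring

/-! ### The Hasse diagram of a rooted forest order -/

section TreeOrder

variable {V : Type*} [PartialOrder V]

/-- This makes upper covers unique: every nontop element will have one parent. -/
theorem CovBy.le_of_lt_of_total (h : ∀ a b c : V, a ≤ b → a ≤ c → b ≤ c ∨ c ≤ b) {a b c : V}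
    (hab : a ⋖ b) (hac : a < c) : b ≤ c := by
  rcases h a b c hab.le hac.le with hbc | hcb
  · exact hbc
  · exact (hcb.eq_or_lt.resolve_right (hab.2 hac)).ge

variable [OrderTop V] [Finite V]

theorem exists_hasse_path (h : ∀ a b c : V, a ≤ b → a ≤ c → b ≤ c ∨ c ≤ b) (b : V) :
    ∃ p : (SimpleGraph.hasse V).Walk ⊤ b, p.IsPath ∧ ∀ x, x ∈ p.support ↔ b ≤ x := by
  induction b using WellFoundedGT.induction with | _ b ih =>
  by_cases hb : b = ⊤
  · subst hb
    exact ⟨SimpleGraph.Walk.nil, by simp, by simp⟩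
  obtain ⟨c, hbc, -⟩ := exists_covBy_le_of_lt (lt_top_iff_ne_top.2 hb)
  obtain ⟨p, hp, hps⟩ := ih c hbc.lt
  have hadj : (SimpleGraph.hasse V).Adj c b := Or.inr hbc
  refine ⟨p.concat hadj, ?_, fun x => ?_⟩
  · rw [SimpleGraph.Walk.concat_isPath_iff, hps]
    exact ⟨hp, hbc.lt.not_ge⟩
  · rw [SimpleGraph.Walk.support_concat, List.mem_append, hps]
    constructor
    · rintro (hx | hx)
      · exact hbc.le.trans hx
      · exact (List.mem_singleton.1 hx).ge
    · intro hx
      rcases hx.eq_or_lt with rfl | hx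
      · simp
      · exact Or.inl (CovBy.le_of_lt_of_total h hbc hx)

/-- Sending a nontop element to the edge towards its unique upper cover is a bijection onto the
edges. A connected graph with one edge fewer than vertices is a tree. -/
theorem hasse_isTree (h : ∀ a b c : V, a ≤ b → a ≤ c → b ≤ c ∨ c ≤ b) :
    (SimpleGraph.hasse V).IsTree := by
  rw [SimpleGraph.isTree_iff_connected_and_card]
  have htop : ∀ a, (SimpleGraph.hasse V).Reachable ⊤ a := fun a =>
    (exists_hasse_path h a).choose.reachable
  have : Nonempty V := ⟨⊤⟩
  refine ⟨SimpleGraph.Connected.mk fun a b => (htop a).symm.trans (htop b), ?_⟩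
  have hcov : ∀ a : V, ∃ b, a ≠ ⊤ → a ⋖ b := fun a => by
    by_cases ha : a = ⊤
    · exact ⟨a, fun h => (h ha).elim⟩
    · obtain ⟨b, hb, -⟩ := exists_covBy_le_of_lt (lt_top_iff_ne_top.2 ha)
      exact ⟨b, fun _ => hb⟩
  choose parent hparent using hcov
  have himage : (SimpleGraph.hasse V).edgeSet = (fun a => s(a, parent a)) '' {⊤}ᶜ := by
    have key : ∀ a b : V, a ⋖ b → s(a, b) ∈ (fun a => s(a, parent a)) '' ({⊤}ᶜ : Set V) := by
      intro a b hab
      have ha : a ≠ ⊤ := fun h => not_top_lt (h ▸ hab.lt)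
      have hp := hparent a ha
      refine ⟨a, ha, ?_⟩
      have : parent a = b := le_antisymm (CovBy.le_of_lt_of_total h hp hab.lt)
        (CovBy.le_of_lt_of_total h hab hp.lt)
      simp only [this]
    ext e
    induction e with | _ a b =>
    constructor
    · rintro (hab | hab)
      · exact key a b hab
      · rw [Sym2.eq_swap]
        exact key b a hab
    · rintro ⟨c, hc, he⟩
      rw [← he]
      exact Or.inl (hparent c hc)
  have hinj : InjOn (fun a => s(a, parent a)) ({⊤}ᶜ : Set V) := by
    intro a ha b hb hab
    rcases Sym2.eq_iff.1 hab with ⟨h, -⟩ | ⟨h₁, h₂⟩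
    · exact h
    · have ha' := (hparent a ha).lt
      have hb' := (hparent b hb).lt
      rw [h₂] at ha'
      rw [← h₁] at hb'
      exact (lt_asymm ha' hb').elim
  rw [himage, Nat.card_coe_set_eq, hinj.ncard_image, ← ncard_singleton (⊤ : V), add_comm,
    ncard_add_ncard_compl]

end TreeOrder

/-! ### The curve of an ultrametric -/

section Balls

variable {ι : Type} {u : ι → ι → ℝ}

/-- The balls of an ultrametric that have more than one element. -/
structure Ball (hu : IsUltrametric u) where
  carrier : Set ι
  radius : ℝ
  exists_eq : ∃ i j, i ≠ j ∧ radius = u i j ∧ carrier = {k | u i j ≤ u i k}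

namespace Ball

variable {hu : IsUltrametric u}

/-- The least ball containing two points. -/
def ofPair (hu : IsUltrametric u) (i j : ι) (h : i ≠ j) : Ball hu :=
  ⟨{k | u i j ≤ u i k}, u i j, i, j, h, rfl, rfl⟩

theorem le_self (hu : IsUltrametric u) (i j : ι) : u i j ≤ u i i := by
  have := hu.min_le i j i
  rwa [hu.symm j i, min_self] at this

/-- Every point of an ultrametric ball is a centre. As `u` measures closeness, a larger radius means
a smaller ball. -/
theorem mem_iff (S : Ball hu) {i : ι} (hi : i ∈ S.carrier) (k : ι) :
    k ∈ S.carrier ↔ S.radius ≤ u i k := by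
  obtain ⟨c, r, a, b, hab, rfl, rfl⟩ := S
  change u a b ≤ u a k ↔ u a b ≤ u i k
  have hi : u a b ≤ u a i := hi
  constructor
  · exact fun hk => (le_min (hu.symm a i ▸ hi) hk).trans (hu.min_le i a k)
  · exact fun hk => (le_min hi hk).trans (hu.min_le a i k)

theorem exists_pair (S : Ball hu) :
    ∃ i ∈ S.carrier, ∃ j ∈ S.carrier, i ≠ j ∧ u i j = S.radius := by
  obtain ⟨c, r, a, b, hab, rfl, rfl⟩ := S
  exact ⟨a, le_self hu a b, b, le_refl (u a b), hab, rfl⟩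

theorem radius_le (S : Ball hu) {i j : ι} (hi : i ∈ S.carrier) (hj : j ∈ S.carrier) :
    S.radius ≤ u i j := (S.mem_iff hi j).1 hj

theorem radius_anti {S S' : Ball hu} (h : S.carrier ⊆ S'.carrier) : S'.radius ≤ S.radius := by
  obtain ⟨i, hi, j, hj, -, hij⟩ := S.exists_pair
  exact hij ▸ S'.radius_le (h hi) (h hj)

theorem carrier_subset {S S' : Ball hu} {i : ι} (hi : i ∈ S.carrier) (hi' : i ∈ S'.carrier)
    (h : S'.radius ≤ S.radius) : S.carrier ⊆ S'.carrier := fun k hk =>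
  (S'.mem_iff hi' k).2 (h.trans (S.radius_le hi hk))

/-- The radius is recovered as the least value of `u` on pairs in the carrier, so inclusion of
carriers is a partial order on balls. -/
theorem carrier_injective : Function.Injective (carrier : Ball hu → Set ι) := by
  intro S S' h
  have hr : S.radius = S'.radius := le_antisymm (radius_anti h.ge) (radius_anti h.le)
  cases S
  cases S'
  simp_all

instance : PartialOrder (Ball hu) := PartialOrder.lift carrier carrier_injective

theorem le_or_le {S S' : Ball hu} {i : ι} (hi : i ∈ S.carrier) (hi' : i ∈ S'.carrier) :
    S ≤ S' ∨ S' ≤ S :=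
  (le_total S'.radius S.radius).imp (carrier_subset hi hi') (carrier_subset hi' hi)

theorem radius_lt {S S' : Ball hu} (h : S < S') : S'.radius < S.radius := by
  refine (radius_anti h.le).lt_of_ne fun heq => ?_
  obtain ⟨i, hi, -⟩ := S.exists_pair
  exact h.not_ge (carrier_subset (h.le hi) hi heq.ge)

theorem total_of_le (S S₁ S₂ : Ball hu) (h₁ : S ≤ S₁) (h₂ : S ≤ S₂) : S₁ ≤ S₂ ∨ S₂ ≤ S₁ := by
  obtain ⟨i, hi, -⟩ := S.exists_pair
  exact le_or_le (h₁ hi) (h₂ hi)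

variable [Finite ι]

instance : Finite (Ball hu) := Finite.of_injective _ carrier_injective

variable [Nontrivial ι]

theorem exists_forall_le (hu : IsUltrametric u) : ∃ S : Ball hu, ∀ S', S' ≤ S := by
  obtain ⟨a, b, hab⟩ := exists_pair_ne ι
  have : Nonempty {p : ι × ι // p.1 ≠ p.2} := ⟨⟨(a, b), hab⟩⟩
  obtain ⟨⟨⟨i, j⟩, hij⟩, hmin⟩ :=
    Finite.exists_min fun p : {p : ι × ι // p.1 ≠ p.2} => u p.1.1 p.1.2
  refine ⟨ofPair hu i j hij, fun S' k _ => ?_⟩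
  by_cases hik : i = k
  · exact hik ▸ le_self hu i j
  · exact hmin ⟨(i, k), hik⟩

noncomputable instance : OrderTop (Ball hu) where
  top := (exists_forall_le hu).choose
  le_top := (exists_forall_le hu).choose_spec

/-- Take the ball spanned by `i` and a closest other point `j`. Any ball containing `i` contains
some `k ≠ i`, and `u i k ≤ u i j`. -/
theorem exists_least (hu : IsUltrametric u) (i : ι) :
    ∃ S : Ball hu, ∀ S', S ≤ S' ↔ i ∈ S'.carrier := by
  obtain ⟨a, ha⟩ := exists_ne i
  have : Nonempty {j // i ≠ j} := ⟨⟨a, ha.symm⟩⟩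
  obtain ⟨⟨j, hij⟩, hmax⟩ := Finite.exists_max fun j : {j // i ≠ j} => u i j
  refine ⟨ofPair hu i j hij, fun S' => ⟨fun h => h (le_self hu i j), fun h => ?_⟩⟩
  refine carrier_subset (le_self hu i j) h ?_
  obtain ⟨a, ha, b, hb, hab, -⟩ := S'.exists_pair
  have : ∃ k ∈ S'.carrier, i ≠ k := by
    by_cases hia : i = a
    exacts [⟨b, hb, hia ▸ hab⟩, ⟨a, ha, hia⟩]
  obtain ⟨k, hk, hik⟩ := this
  exact (S'.radius_le h hk).trans (hmax ⟨k, hik⟩)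

/-- The least ball containing a point. -/
noncomputable def least (hu : IsUltrametric u) (i : ι) : Ball hu := (exists_least hu i).choose

theorem least_le_iff {i : ι} {S : Ball hu} : least hu i ≤ S ↔ i ∈ S.carrier :=
  (exists_least hu i).choose_spec S

end Ball

end Balls

theorem three_le_ncard_add_ncard {A B : Type*} [Finite A] [Finite B] {s : Set A} {t : Set B}
    {x y z : s ⊕ t} (hxy : x ≠ y) (hxz : x ≠ z) (hyz : y ≠ z) : 3 ≤ s.ncard + t.ncard := by
  classical
  have := Fintype.ofFinite (s ⊕ t)
  have h₁ : Nat.card (s ⊕ t) = s.ncard + t.ncard := by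
    rw [Nat.card_sum, Nat.card_coe_set_eq, Nat.card_coe_set_eq]
  rw [← h₁, Nat.card_eq_fintype_card, ← Finset.card_eq_three.2 ⟨x, y, z, hxy, hxz, hyz, rfl⟩]
  exact Finset.card_le_univ _

section CurveOfUltrametric

variable {m : ℕ} [Nontrivial (Fin m)] {u : Fin m → Fin m → ℝ}

/-- The tree of balls of an ultrametric, rooted at the ball of all points. -/
noncomputable def ballType (hu : IsUltrametric u) : CombType m where
  V := Ball hu
  tree := SimpleGraph.hasse (Ball hu)
  isTree := hasse_isTree Ball.total_of_le
  mark := Fin.cases ⊤ fun i => Ball.least hu i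
  stable S := by
    set mark : Fin (m + 1) → Ball hu := Fin.cases ⊤ fun i => Ball.least hu i
    -- Each point of `S` yields an edge or end at `S`: the child ball containing the point, or the
    -- end of the point itself.
    have hitem : ∀ k ∈ S.carrier,
        ∃ x : (SimpleGraph.hasse (Ball hu)).neighborSet S ⊕ {i | mark i = S},
          (∃ (c : Ball hu) (hc : c ⋖ S), k ∈ c.carrier ∧ x = Sum.inl ⟨c, Or.inr hc⟩) ∨
          ∃ h : mark k.succ = S, x = Sum.inr ⟨k.succ, h⟩ := by
      intro k hk
      by_cases h : mark k.succ = S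
      · exact ⟨Sum.inr ⟨k.succ, h⟩, Or.inr ⟨h, rfl⟩⟩
      · have hlt : Ball.least hu k < S := (Ball.least_le_iff.2 hk).lt_of_ne h
        obtain ⟨c, hle, hc⟩ := exists_le_covBy_of_lt hlt
        exact ⟨Sum.inl ⟨c, Or.inr hc⟩, Or.inl ⟨c, hc, Ball.least_le_iff.1 hle, rfl⟩⟩
    -- The third item points to the root: the edge to the parent, or the root end at the top ball.
    obtain ⟨z, hz⟩ : ∃ z : (SimpleGraph.hasse (Ball hu)).neighborSet S ⊕ {i | mark i = S},
        (∃ (c : Ball hu) (hc : S ⋖ c), z = Sum.inl ⟨c, Or.inl hc⟩) ∨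
          ∃ h : mark 0 = S, z = Sum.inr ⟨0, h⟩ := by
      by_cases h : S = ⊤
      · exact ⟨Sum.inr ⟨0, h.symm⟩, Or.inr ⟨h.symm, rfl⟩⟩
      · obtain ⟨c, hc, -⟩ := exists_covBy_le_of_lt (lt_top_iff_ne_top.2 h)
        exact ⟨Sum.inl ⟨c, Or.inl hc⟩, Or.inl ⟨c, hc, rfl⟩⟩
    obtain ⟨i, hi, j, hj, hij, hr⟩ := S.exists_pair
    obtain ⟨x, hx⟩ := hitem i hi
    obtain ⟨y, hy⟩ := hitem j hj
    have hne : ∀ k, ∀ x : (SimpleGraph.hasse (Ball hu)).neighborSet S ⊕ {i | mark i = S},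
        ((∃ (c : Ball hu) (hc : c ⋖ S), k ∈ c.carrier ∧ x = Sum.inl ⟨c, Or.inr hc⟩) ∨
          ∃ h : mark k.succ = S, x = Sum.inr ⟨k.succ, h⟩) → x ≠ z := by
      rintro k x (⟨c, hc, -, rfl⟩ | ⟨h, rfl⟩) rfl
      · rcases hz with ⟨c', hc', h'⟩ | ⟨_, h'⟩
        · obtain rfl : c = c' := congrArg Subtype.val (Sum.inl_injective h')
          exact lt_asymm hc.lt hc'.lt
        · cases h'
      · rcases hz with ⟨c', hc', h'⟩ | ⟨_, h'⟩
        · cases h'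
        · exact Fin.succ_ne_zero k (congrArg Subtype.val (Sum.inr_injective h'))
    refine three_le_ncard_add_ncard (x := x) (y := y) (z := z) ?_ (hne i x hx) (hne j y hy)
    rintro rfl
    rcases hx with ⟨c, hc, hic, rfl⟩ | ⟨h, rfl⟩
    · rcases hy with ⟨c', hc', hjc, h'⟩ | ⟨_, h'⟩
      · obtain rfl : c = c' := congrArg Subtype.val (Sum.inl_injective h')
        -- Two points realizing the radius of `S` cannot share a child, whose radius is strictly
        -- larger.
        exact (Ball.radius_lt hc.lt).not_ge (hr ▸ c.radius_le hic hjc)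
      · cases h'
    · rcases hy with ⟨c', hc', hjc, h'⟩ | ⟨_, h'⟩
      · cases h'
      · exact hij (Fin.succ_injective _ (congrArg Subtype.val (Sum.inr_injective h')))

theorem ballType_isAncestor_iff (hu : IsUltrametric u) (S S' : Ball hu) :
    (ballType hu).IsAncestor S S' ↔ S' ≤ S := by
  obtain ⟨p, hp, hps⟩ := exists_hasse_path Ball.total_of_le S'
  rw [← hps S]
  change S ∈ ((ballType hu).path (⊤ : Ball hu) S').support ↔ _
  rw [← (ballType hu).eq_path hp]
  rfl

/-- The lengths for which a ball has distance to the root given by the radii. -/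
noncomputable def ballLength (hu : IsUltrametric u) : Sym2 (ballType hu).V → ℝ :=
  (ballType hu).lengthOf Ball.radius

theorem ballLength_pos (hu : IsUltrametric u) (e : Sym2 (ballType hu).V)
    (he : e ∈ (ballType hu).tree.edgeSet) : 0 < ballLength hu e := by
  induction e with | _ S S' =>
  refine abs_pos.2 (sub_ne_zero.2 ?_)
  rcases he with he | he
  · exact (Ball.radius_lt he.lt).ne'
  · exact (Ball.radius_lt he.lt).ne

theorem ballType_dist (hu : IsUltrametric u) (S : Ball hu) :
    (ballType hu).dist (ballLength hu) (ballType hu).root S =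
      S.radius - (⊤ : Ball hu).radius :=
  (ballType hu).dist_lengthOf Ball.radius (fun _ _ _ h =>
    Ball.radius_anti ((ballType_isAncestor_iff hu _ _).1 h)) S

/-- The common ancestors of two ends are the balls containing both points. All have radius at most
`u i j`, and the ball spanned by the pair attains it. -/
theorem ballType_endGromov (hu : IsUltrametric u) {i j : Fin m} (hij : i ≠ j) :
    (ballType hu).endGromov (ballLength hu) i j = u i j - (⊤ : Ball hu).radius := by
  have hanc : ∀ (S : Ball hu) (k : Fin m),
      (ballType hu).IsAncestor S ((ballType hu).mark k.succ) ↔ k ∈ S.carrier := fun S k =>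
    (ballType_isAncestor_iff hu S (Ball.least hu k)).trans Ball.least_le_iff
  apply le_antisymm
  · obtain ⟨c, hci, hcj, hc⟩ := (ballType hu).exists_meet
      ((ballType hu).mark i.succ) ((ballType hu).mark j.succ)
    rw [CombType.endGromov, hc, ballType_dist hu c]
    exact sub_le_sub_right (Ball.radius_le c ((hanc c i).1 hci) ((hanc c j).1 hcj)) _
  · have hi : i ∈ (Ball.ofPair hu i j hij).carrier := Ball.le_self hu i j
    have hj : j ∈ (Ball.ofPair hu i j hij).carrier := le_refl (u i j)
    have := CombType.IsAncestor.le_gromov (fun e he => (ballLength_pos hu e he).le)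
      ((hanc _ i).2 hi) ((hanc _ j).2 hj)
    rwa [ballType_dist] at this

end CurveOfUltrametric

/-! ### The projection of the moduli space of radially aligned curves -/

section Projection

variable {m : ℕ} {Γ : SimpleGraph (Fin m)}

theorem restrict_ballType [Nontrivial (Fin m)] {u : Fin m → Fin m → ℝ} (hu : IsUltrametric u) :
    restrict Γ ((ballType hu).endGromov (ballLength hu)) ((ballType hu).endGromov_comm _) =
      fun e => restrict Γ u hu.symm e - (⊤ : Ball hu).radius := by
  ext ⟨e, he⟩
  induction e with | _ i j =>
  have hij : Γ.Adj i j := he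
  exact ballType_endGromov hu hij.ne

theorem Curve.projection_point_mem {C : Curve m} :
    projection Γ (C.toCombType.point C.length) ∈ reducedBergmanFan (cycleMatroid Γ) := by
  refine ⟨_, ?_, (C.toCombType.projection_point Γ C.length).symm⟩
  rw [mem_bergmanFan_iff]
  convert! (C.toCombType.endGromov_isUltrametric fun e he => (C.length_pos e he).le).hasFlatLevels Γ
  ext e
  simp

theorem nonempty_ground [Nontrivial (Fin m)] (hΓ : Γ.Connected) :
    Nonempty (cycleMatroid Γ).E := by
  obtain ⟨a, b, hab⟩ := exists_pair_ne (Fin m)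
  obtain ⟨c, hc⟩ := hΓ.preconnected.exists_adj_of_nontrivial a
  exact ⟨⟨s(a, c), hc⟩⟩

theorem image_radialModuli [Nontrivial (Fin m)] (hΓ : Γ.Connected) :
    projection Γ '' radialModuli m = reducedBergmanFan (cycleMatroid Γ) := by
  have := nonempty_ground hΓ
  apply Subset.antisymm
  · rintro _ ⟨_, ⟨C, rfl⟩, rfl⟩
    exact C.toCurve.projection_point_mem
  · rintro _ ⟨w, hw, rfl⟩
    -- The extension of `-w` to all pairs supplies the ball tree; the radius of the top ball is the
    -- shift absorbed by `L`.
    obtain ⟨u, hu, hur⟩ := ((mem_bergmanFan_iff w).1 hw).exists_isUltrametric hΓ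
    let C : Curve m := ⟨ballType hu, ballLength hu, ballLength_pos hu⟩
    refine ⟨_, ⟨⟨C, fun a b => C.radius a ≤ C.radius b, fun _ _ => Iff.rfl⟩, rfl⟩, ?_⟩
    refine ((ballType hu).projection_point Γ (ballLength hu)).trans ?_
    rw [restrict_ballType, hur]
    refine mkQ_lineality_eq (⊤ : Ball hu).radius fun e => ?_
    simp only [Pi.neg_apply]
    ring

theorem image_radialCones [Nontrivial (Fin m)] (hΓ : Γ.Connected) :
    {τ | ∃ σ ∈ radialCones m, τ = projection Γ '' σ} = bergmanCones (cycleMatroid Γ) := by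
  have := nonempty_ground hΓ
  apply Subset.antisymm
  · rintro _ ⟨_, ⟨T, rfl⟩, rfl⟩
    obtain ⟨ℓ, hℓ, hle⟩ := T.realizable
    rw [T.image_cone Γ hℓ hle]
    exact ((T.endGromov_isUltrametric fun e he =>
      (hℓ e he).le).hasFlatLevels Γ).monotoneCone_mem_bergmanCones
  · rintro _ ⟨r, F, hF, rfl⟩
    -- The depth function of the chain plays the role of a generic point of the cone: its ball tree,
    -- ordered by radius, is the required type.
    obtain ⟨u, hu, hur⟩ := (hF.hasFlatLevels isFlat_empty_cycleMatroid).exists_isUltrametric hΓ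
    let T : RadialType m :=
      { toCombType := ballType hu
        le := fun a b => (ballType hu).dist (ballLength hu) (ballType hu).root a ≤
          (ballType hu).dist (ballLength hu) (ballType hu).root b
        realizable := ⟨ballLength hu, ballLength_pos hu, fun _ _ => Iff.rfl⟩ }
    refine ⟨_, ⟨T, rfl⟩, ?_⟩
    refine Eq.trans ?_ (T.image_cone Γ (ballLength_pos hu) fun _ _ => Iff.rfl).symm
    change _ = monotoneCone _ (restrict Γ ((ballType hu).endGromov (ballLength hu)) _)
    rw [restrict_ballType, hur, hF.flatCone_eq, monotoneCone_sub_const]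

end Projection

end RadialCurves

theorem mainTheorem3 (m : ℕ) (hm : 2 ≤ m) (Γ : SimpleGraph (Fin m)) (hΓ : Γ.Connected) :
    RadialCurves.projection Γ '' RadialCurves.radialModuli m =
        RadialCurves.reducedBergmanFan (RadialCurves.cycleMatroid Γ) ∧
    {τ | ∃ σ ∈ RadialCurves.radialCones m, τ = RadialCurves.projection Γ '' σ} =
        RadialCurves.bergmanCones (RadialCurves.cycleMatroid Γ) := by
  have : Nontrivial (Fin m) := Fin.nontrivial_iff_two_le.2 hm
  exact ⟨RadialCurves.image_radialModuli hΓ, RadialCurves.image_radialCones hΓ⟩
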